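/- Let $V$ be the $5$-dimensional space of real symmetric $3\times 3$ matrices $\sigma=(\sigma_{kl})$ with $\sigma_{22}=\sigma_{13}+\sigma_{31}$. With $E_{kl}$ the matrix units, let $$\sigma_1=2E_{11},\quad \sigma_2=E_{12}+E_{21},\quad \sigma_3=E_{13}+2E_{22}+E_{31},\quad \sigma_4=E_{23}+E_{32},\quad \sigma_5=2E_{33},$$ which form a basis of $V$. Let $W\subset\wedge^2V$ be the subspace spanned by $$\sigma_1\wedge\sigma_4-\sigma_2\wedge\sigma_3,\qquad \sigma_1\wedge\sigma_5-\sigma_2\wedge\sigma_4,\qquad \sigma_2\wedge\sigma_5-\sigma_3\wedge\sigma_4 .$$ Let $\mathfrak g=V\oplus(\wedge^2V)/W$ be the real Lie algebra with bracket $[(v,a),(w,b)]=(0,\;v\wedge w \bmod W)$. It is $2$-step nilpotent and $12$-dimensional. Let $G$ be the simply connected Lie group with Lie algebra $\mathfrak g$, that is, $\mathfrak g$ with its standard manifold structure and the product $x\cdot y=x+y+\tfrac12[x,y]$; this is a simply connected Lie group whose Lie algebra is isomorphic to $\mathfrak g$. Then the action on $G$ of the group $\mathrm{Aut}(G)$ of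 continuous automorphisms of $G$ has no dense orbit: for every $g\in G$ the set $\{\varphi(g):\varphi\in\mathrm{Aut}(G)\}$ is not dense in $G$. -/

import Mathlib

open scoped Manifold ContDiff

noncomputable section

namespace TwoStep

theorem update_pair_zero {X : Type} (a b x : X) : Function.update ![a, b] 0 x = ![x, b] := by
  ext i; fin_cases i <;> rfl

theorem update_pair_one {X : Type} (a b x : X) : Function.update ![a, b] 1 x = ![a, x] := by
  ext i; fin_cases i <;> rfl

section General

variable (V : Type) [AddCommGroup V] [Module ℝ V] (W : Submodule ℝ (⋀[ℝ]^2 V))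

/-- The underlying space `V ⊕ (⋀² V) / W` of the 2-step nilpotent Lie algebra attached to a
real vector space `V` and a subspace `W` of its second exterior power. -/
def Alg : Type := V × ((⋀[ℝ]^2 V) ⧸ W)

instance : AddCommGroup (Alg V W) := inferInstanceAs (AddCommGroup (V × ((⋀[ℝ]^2 V) ⧸ W)))

instance : Module ℝ (Alg V W) := inferInstanceAs (Module ℝ (V × ((⋀[ℝ]^2 V) ⧸ W)))

variable {V}

/-- The wedge product `v ∧ w` in the second exterior power of `V`. -/
def wedge (v w : V) : ⋀[ℝ]^2 V := exteriorPower.ιMulti ℝ 2 ![v, w]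

/-- The wedge product as a bilinear map. -/
def wedgeBilin : V →ₗ[ℝ] V →ₗ[ℝ] ⋀[ℝ]^2 V :=
  LinearMap.mk₂ ℝ wedge
    (fun a b c => by
      have := (exteriorPower.ιMulti ℝ 2 (M := V)).map_update_add ![a, c] 0 a b
      simpa only [update_pair_zero, wedge] using this)
    (fun r a b => by
      have := (exteriorPower.ιMulti ℝ 2 (M := V)).map_update_smul ![a, b] 0 r a
      simpa only [update_pair_zero, wedge] using this)
    (fun a b c => by
      have := (exteriorPower.ιMulti ℝ 2 (M := V)).map_update_add ![a, c] 1 b c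
      simpa only [update_pair_one, wedge] using this)
    (fun r a b => by
      have := (exteriorPower.ιMulti ℝ 2 (M := V)).map_update_smul ![a, b] 1 r b
      simpa only [update_pair_one, wedge] using this)

/-- `(v, w) ↦ v ∧ w mod W` as a bilinear map. -/
def wedgeModBilin : V →ₗ[ℝ] V →ₗ[ℝ] ((⋀[ℝ]^2 V) ⧸ W) := wedgeBilin.compr₂ W.mkQ

theorem wedgeModBilin_apply (v w : V) :
    wedgeModBilin W v w = W.mkQ (wedge v w) := rfl

theorem wedgeModBilin_self (v : V) : wedgeModBilin W v v = 0 := by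
  have : wedge v v = 0 :=
    (exteriorPower.ιMulti ℝ 2 (M := V)).map_eq_zero_of_eq ![v, v] (i := 0) (j := 1) rfl (by decide)
  rw [wedgeModBilin_apply, this, map_zero]

/-- The bracket: `[(v, a), (w, b)] = (0, v ∧ w mod W)`. -/
instance : Bracket (Alg V W) (Alg V W) where
  bracket x y := ((0 : V), wedgeModBilin W x.1 y.1)

theorem bracket_eq (x y : Alg V W) : ⁅x, y⁆ = ((0 : V), wedgeModBilin W x.1 y.1) := rfl

instance : LieRing (Alg V W) where
  add_lie x y z := by
    refine Prod.ext (add_zero (0 : V)).symm ?_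
    exact LinearMap.map_add₂ (wedgeModBilin W) x.1 y.1 z.1
  lie_add x y z := by
    refine Prod.ext (add_zero (0 : V)).symm ?_
    exact (wedgeModBilin W x.1).map_add y.1 z.1
  lie_self x := Prod.ext rfl (wedgeModBilin_self W x.1)
  leibniz_lie x y z := by
    have h : ∀ u : V, wedgeModBilin W u 0 = 0 := fun u => map_zero _
    have h' : ∀ u : V, wedgeModBilin W 0 u = 0 := fun u => LinearMap.map_zero₂ _ u
    refine Prod.ext (add_zero (0 : V)).symm ?_
    change wedgeModBilin W x.1 0 = wedgeModBilin W 0 z.1 + wedgeModBilin W y.1 0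
    rw [h, h, h', add_zero]

instance : LieAlgebra ℝ (Alg V W) where
  lie_smul t x y := by
    refine Prod.ext (smul_zero t).symm ?_
    exact (wedgeModBilin W x.1).map_smul t y.1

theorem lie_lie_eq_zero (x y z : Alg V W) : ⁅x, ⁅y, z⁆⁆ = 0 :=
  Prod.ext rfl (map_zero (wedgeModBilin W x.1))

theorem lie_lie_eq_zero' (x y z : Alg V W) : ⁅⁅x, y⁆, z⁆ = 0 :=
  Prod.ext rfl (LinearMap.map_zero₂ (wedgeModBilin W) z.1)

variable (V)

/-- The group attached to the Lie algebra `Alg V W`: the same underlying space, with the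
Baker-Campbell-Hausdorff product `x * y = x + y + ½ [x, y]` (all further terms of the series vanish
in a 2-step nilpotent Lie algebra). -/
def Grp : Type := Alg V W

variable {V}

/-- The exponential map, which is the identity in these coordinates. -/
def exp : Alg V W ≃ Grp V W := Equiv.refl _

/-- The logarithm, which is the identity in these coordinates. -/
def log : Grp V W ≃ Alg V W := Equiv.refl _

instance : Group (Grp V W) where
  mul x y := exp W (log W x + log W y + (1 / 2 : ℝ) • ⁅log W x, log W y⁆)
  one := exp W 0
  inv x := exp W (-log W x)
  mul_assoc x y z := by
    change (log W x + log W y + (1 / 2 : ℝ) • ⁅log W x, log W y⁆) + log W z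
        + (1 / 2 : ℝ) • ⁅log W x + log W y + (1 / 2 : ℝ) • ⁅log W x, log W y⁆, log W z⁆
      = log W x + (log W y + log W z + (1 / 2 : ℝ) • ⁅log W y, log W z⁆)
        + (1 / 2 : ℝ) • ⁅log W x, log W y + log W z + (1 / 2 : ℝ) • ⁅log W y, log W z⁆⁆
    simp only [add_lie, lie_add, smul_lie, lie_smul, lie_lie_eq_zero, lie_lie_eq_zero', smul_zero,
      smul_add, add_zero]
    abel
  one_mul x := by
    change (0 : Alg V W) + log W x + (1 / 2 : ℝ) • ⁅(0 : Alg V W), log W x⁆ = log W x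
    simp
  mul_one x := by
    change log W x + (0 : Alg V W) + (1 / 2 : ℝ) • ⁅log W x, (0 : Alg V W)⁆ = log W x
    simp
  inv_mul_cancel x := by
    change -log W x + log W x + (1 / 2 : ℝ) • ⁅-log W x, log W x⁆ = 0
    simp

theorem mul_eq (x y : Grp V W) :
    x * y = exp W (log W x + log W y + (1 / 2 : ℝ) • ⁅log W x, log W y⁆) := rfl

variable [FiniteDimensional ℝ V]

instance : FiniteDimensional ℝ (Alg V W) :=
  inferInstanceAs (FiniteDimensional ℝ (V × ((⋀[ℝ]^2 V) ⧸ W)))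

/-- A norm on the finite-dimensional space `Alg V W`, the maximum norm in some basis. All norms on
it are equivalent, so its topology and its smooth structure do not depend on the choice. -/
instance : NormedAddCommGroup (Alg V W) :=
  NormedAddCommGroup.induced (Alg V W) (Fin (Module.finrank ℝ (Alg V W)) → ℝ)
    (Module.finBasis ℝ (Alg V W)).equivFun (Module.finBasis ℝ (Alg V W)).equivFun.injective

instance : NormedSpace ℝ (Alg V W) :=
  NormedSpace.induced ℝ (Alg V W) (Fin (Module.finrank ℝ (Alg V W)) → ℝ)
    (Module.finBasis ℝ (Alg V W)).equivFun.toLinearMap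

/-- The group carries the topology of the real vector space `Alg V W` ... -/
instance : TopologicalSpace (Grp V W) := inferInstanceAs (TopologicalSpace (Alg V W))

/-- ... and its standard manifold structure. -/
instance : ChartedSpace (Alg V W) (Grp V W) := inferInstanceAs (ChartedSpace (Alg V W) (Alg V W))

instance (n : WithTop ℕ∞) : IsManifold 𝓘(ℝ, Alg V W) n (Grp V W) :=
  inferInstanceAs (IsManifold 𝓘(ℝ, Alg V W) n (Alg V W))

/-- The bracket as a bilinear map. -/
def lieBilin : Alg V W →ₗ[ℝ] Alg V W →ₗ[ℝ] Alg V W :=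
  LinearMap.mk₂ ℝ (fun x y => ⁅x, y⁆) add_lie smul_lie lie_add lie_smul

theorem contDiff_lie (n : WithTop ℕ∞) :
    ContDiff ℝ n (fun p : Alg V W × Alg V W => ⁅p.1, p.2⁆) := by
  let B : Alg V W →L[ℝ] Alg V W →L[ℝ] Alg V W :=
    LinearMap.toContinuousLinearMap (LinearMap.toContinuousLinearMap.toLinearMap ∘ₗ lieBilin W)
  exact (B.contDiff.comp contDiff_fst).clm_apply contDiff_snd

theorem contDiff_mul_log (n : WithTop ℕ∞) :
    ContDiff ℝ n (fun p : Alg V W × Alg V W => p.1 + p.2 + (1 / 2 : ℝ) • ⁅p.1, p.2⁆) :=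
  (contDiff_fst.add contDiff_snd).add ((contDiff_lie W n).const_smul _)

/-- `Grp V W` is a Lie group (smooth, and even real analytic). -/
instance (n : WithTop ℕ∞) : LieGroup 𝓘(ℝ, Alg V W) n (Grp V W) where
  contMDiff_mul := by
    have h := (contDiff_mul_log W n).contMDiff
    rw [modelWithCornersSelf_prod, ← chartedSpaceSelf_prod] at h
    exact h
  contMDiff_inv := by
    have h : ContDiff ℝ n (fun x : Alg V W => -x) := contDiff_neg
    exact h.contMDiff

end General

/-- The 5-dimensional space of real symmetric `3 × 3` matrices with `σ₂₂ = σ₁₃ + σ₃₁`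
(indices start at `0` in the code). -/
def V : Submodule ℝ (Matrix (Fin 3) (Fin 3) ℝ) where
  carrier := {σ | σ.IsSymm ∧ σ 1 1 = σ 0 2 + σ 2 0}
  add_mem' := by
    rintro a b ⟨ha, ha'⟩ ⟨hb, hb'⟩
    refine ⟨ha.add hb, ?_⟩
    simp only [Matrix.add_apply, ha', hb']
    ring
  zero_mem' := ⟨Matrix.isSymm_zero, by simp⟩
  smul_mem' := by
    rintro c a ⟨ha, ha'⟩
    refine ⟨ha.smul c, ?_⟩
    simp only [Matrix.smul_apply, ha', smul_add]

theorem mem_V (σ : Matrix (Fin 3) (Fin 3) ℝ) :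
    σ ∈ V ↔ σ.IsSymm ∧ σ 1 1 = σ 0 2 + σ 2 0 := Iff.rfl

def σ₁ : V := ⟨!![2, 0, 0; 0, 0, 0; 0, 0, 0], by
  rw [mem_V, Matrix.IsSymm.ext_iff]; simp [Fin.forall_fin_succ]⟩

def σ₂ : V := ⟨!![0, 1, 0; 1, 0, 0; 0, 0, 0], by
  rw [mem_V, Matrix.IsSymm.ext_iff]; simp [Fin.forall_fin_succ]⟩

def σ₃ : V := ⟨!![0, 0, 1; 0, 2, 0; 1, 0, 0], by
  rw [mem_V, Matrix.IsSymm.ext_iff]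
  refine ⟨by simp [Fin.forall_fin_succ], ?_⟩
  change (2 : ℝ) = 1 + 1
  norm_num⟩

def σ₄ : V := ⟨!![0, 0, 0; 0, 0, 1; 0, 1, 0], by
  rw [mem_V, Matrix.IsSymm.ext_iff]; simp [Fin.forall_fin_succ]⟩

def σ₅ : V := ⟨!![0, 0, 0; 0, 0, 0; 0, 0, 2], by
  rw [mem_V, Matrix.IsSymm.ext_iff]; simp [Fin.forall_fin_succ]⟩

/-- The 3-dimensional subspace `W` of `⋀² V`. -/
def W : Submodule ℝ (⋀[ℝ]^2 V) :=
  Submodule.span ℝ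
    {wedge σ₁ σ₄ - wedge σ₂ σ₃, wedge σ₁ σ₅ - wedge σ₂ σ₄, wedge σ₂ σ₅ - wedge σ₃ σ₄}

/-- The Lie algebra `V ⊕ (⋀² V) / W`. -/
abbrev 𝔤 : Type := Alg V W

/-- The simply connected nilpotent Lie group with Lie algebra `𝔤`. -/
abbrev G : Type := Grp V W

end TwoStep

end

/-!
A continuous automorphism of `G` is a Lie algebra automorphism in exponential coordinates, so it
acts on `V` through an element `A` of `GL(V)` whose second exterior power preserves `W`. The cubic
expression `w ∧ w ∧ σ ∈ ⋀⁵ V ≅ ℝ` for `w ∈ W` and `σ ∈ V` is multiplied by `det A` when `A` acts on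
`w` and `σ`; in suitable coordinates `u ∈ ℝ³` of `w` it equals `-uᵀ σ u`. Hence `A` preserves the
set of definite matrices in `V`. This set and its complement both have nonempty interior, so no
orbit is dense.
-/

open scoped commutatorElement

noncomputable section

namespace TwoStep

section ExpLog

variable {V : Type} [AddCommGroup V] [Module ℝ V] (W : Submodule ℝ (⋀[ℝ]^2 V))

theorem exp_log (g : Grp V W) : exp W (log W g) = g := rfl

theorem exp_add (x y : Alg V W) :
    exp W (x + y) = exp W x * exp W y * exp W (-(1 / 2 : ℝ) • ⁅x, y⁆) := by
  change x + y = (x + y + (1 / 2 : ℝ) • ⁅x, y⁆) + -(1 / 2 : ℝ) • ⁅x, y⁆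
    + (1 / 2 : ℝ) • ⁅x + y + (1 / 2 : ℝ) • ⁅x, y⁆, -(1 / 2 : ℝ) • ⁅x, y⁆⁆
  rw [lie_smul, lie_lie_eq_zero]
  module

theorem exp_lie (x y : Alg V W) : exp W ⁅x, y⁆ = ⁅exp W x, exp W y⁆ := by
  rw [commutatorElement_def, mul_assoc _ _ (exp W y)⁻¹, ← mul_inv_rev, eq_mul_inv_iff_mul_eq]
  change ⁅x, y⁆ + (y + x + (1 / 2 : ℝ) • ⁅y, x⁆)
    + (1 / 2 : ℝ) • ⁅⁅x, y⁆, y + x + (1 / 2 : ℝ) • ⁅y, x⁆⁆ = x + y + (1 / 2 : ℝ) • ⁅x, y⁆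
  rw [lie_lie_eq_zero', ← lie_skew x y]
  module

variable {W}

theorem commute_exp_iff {x y : Alg V W} : Commute (exp W x) (exp W y) ↔ ⁅x, y⁆ = 0 := by
  rw [← commutatorElement_eq_one_iff_commute, ← exp_lie]
  exact (exp W).apply_eq_iff_eq

theorem exp_add_of_commute {x y : Alg V W} (h : Commute (exp W x) (exp W y)) :
    exp W (x + y) = exp W x * exp W y := by
  rw [exp_add, commute_exp_iff.1 h, smul_zero]
  exact mul_one _

theorem commute_exp_smul (s t : ℝ) (x : Alg V W) : Commute (exp W (s • x)) (exp W (t • x)) := by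
  rw [commute_exp_iff, smul_lie, lie_smul, lie_self, smul_zero, smul_zero]

end ExpLog

section Differential

variable {V V' : Type} [AddCommGroup V] [Module ℝ V] [AddCommGroup V'] [Module ℝ V']
  {W : Submodule ℝ (⋀[ℝ]^2 V)} {W' : Submodule ℝ (⋀[ℝ]^2 V')}

theorem log_map_exp_lie (φ : Grp V W →* Grp V' W') (x y : Alg V W) :
    log W' (φ (exp W ⁅x, y⁆)) = ⁅log W' (φ (exp W x)), log W' (φ (exp W y))⁆ := by
  apply (exp W').injective
  rw [exp_log, exp_lie, map_commutatorElement, exp_lie, exp_log, exp_log]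

theorem log_map_exp_add_of_commute (φ : Grp V W →* Grp V' W') {x y : Alg V W}
    (h : Commute (exp W x) (exp W y)) :
    log W' (φ (exp W (x + y))) = log W' (φ (exp W x)) + log W' (φ (exp W y)) := by
  apply (exp W').injective
  rw [exp_log, exp_add_of_commute h, map_mul φ,
    exp_add_of_commute (by simpa only [exp_log] using h.map φ), exp_log, exp_log]

variable [FiniteDimensional ℝ V] [FiniteDimensional ℝ V']

theorem continuous_exp : Continuous (exp W) := continuous_id

theorem continuous_log : Continuous (log W) := continuous_id

theorem log_map_exp_smul (φ : Grp V W →ₜ* Grp V' W') (t : ℝ) (x : Alg V W) :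
    log W' (φ (exp W (t • x))) = t • log W' (φ (exp W x)) := by
  let oneParam : ℝ →+ Alg V' W' := AddMonoidHom.mk' (fun s => log W' (φ (exp W (s • x))))
    fun s s' => by
      rw [add_smul]
      exact log_map_exp_add_of_commute φ.toMonoidHom (commute_exp_smul s s' x)
  have continuous_oneParam : Continuous oneParam :=
    continuous_log.comp (φ.continuous.comp (continuous_exp.comp
      (continuous_id.smul continuous_const)))
  simpa only [smul_eq_mul, mul_one, oneParam, AddMonoidHom.mk'_apply, one_smul] using
    map_real_smul oneParam continuous_oneParam t 1

/-- The differential at the identity of a continuous group homomorphism, in exponential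
coordinates, where it is the homomorphism itself. -/
def toLieHom (φ : Grp V W →ₜ* Grp V' W') : Alg V W →ₗ⁅ℝ⁆ Alg V' W' where
  toFun x := log W' (φ (exp W x))
  map_add' x y := by
    apply (exp W').injective
    have map_lie := log_map_exp_lie (φ : Grp V W →* Grp V' W') x y
    simp only [MonoidHom.coe_coe] at map_lie
    rw [exp_add, exp_log, exp_add, map_mul φ, map_mul φ, exp_log, exp_log, ← map_lie,
      ← log_map_exp_smul, exp_log]
  map_smul' := log_map_exp_smul φ
  map_lie' := log_map_exp_lie φ.toMonoidHom _ _

/-- The Lie algebra isomorphism attached to an isomorphism of topological groups. -/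
def toLieEquiv (φ : Grp V W ≃ₜ* Grp V' W') : Alg V W ≃ₗ⁅ℝ⁆ Alg V' W' :=
  { toLieHom (φ : Grp V W →ₜ* Grp V' W') with
    invFun := fun y => log W (φ.symm (exp W' y))
    left_inv := φ.symm_apply_apply
    right_inv := φ.apply_symm_apply }

end Differential

section LinearPart

variable {V V' : Type} [AddCommGroup V] [Module ℝ V] [AddCommGroup V'] [Module ℝ V']
  (W : Submodule ℝ (⋀[ℝ]^2 V)) (W' : Submodule ℝ (⋀[ℝ]^2 V'))

/-- The projection of `V ⊕ (⋀² V) / W` onto `V`. -/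
def proj : Alg V W →ₗ[ℝ] V := LinearMap.fst ℝ V ((⋀[ℝ]^2 V) ⧸ W)

/-- The inclusion of `V` into `V ⊕ (⋀² V) / W`; it is not a Lie algebra homomorphism. -/
def incl : V →ₗ[ℝ] Alg V W := LinearMap.inl ℝ V ((⋀[ℝ]^2 V) ⧸ W)

/-- The linear map from `⋀² V` to the center of `V ⊕ (⋀² V) / W` given by reduction modulo `W`. -/
def ofWedge : ⋀[ℝ]^2 V →ₗ[ℝ] Alg V W := LinearMap.inr ℝ V ((⋀[ℝ]^2 V) ⧸ W) ∘ₗ W.mkQ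

theorem proj_ofWedge (w : ⋀[ℝ]^2 V) : proj W (ofWedge W w) = 0 := rfl

theorem ofWedge_eq_zero_iff {w : ⋀[ℝ]^2 V} : ofWedge W w = 0 ↔ w ∈ W := by
  rw [← Submodule.Quotient.mk_eq_zero W]
  exact LinearMap.inr_injective.eq_iff

theorem exists_eq_incl_add_ofWedge (x : Alg V W) : ∃ w, x = incl W (proj W x) + ofWedge W w := by
  obtain ⟨w, hw⟩ := W.mkQ_surjective x.2
  exact ⟨w, Prod.ext (add_zero _).symm ((zero_add _).trans hw).symm⟩

theorem ιMulti_two_eq_wedge (a : Fin 2 → V) :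
    exteriorPower.ιMulti ℝ 2 a = wedge (a 0) (a 1) :=
  congrArg _ (FinVec.etaExpand_eq a).symm

variable {W W'}

/-- The linear map `V → V'` induced by a Lie algebra homomorphism on the quotients by `(⋀² V) / W`
and `(⋀² V') / W'`. -/
def linearPart (f : Alg V W →ₗ⁅ℝ⁆ Alg V' W') : V →ₗ[ℝ] V' :=
  proj W' ∘ₗ (f : Alg V W →ₗ[ℝ] Alg V' W') ∘ₗ incl W

theorem map_ofWedge (f : Alg V W →ₗ⁅ℝ⁆ Alg V' W') (w : ⋀[ℝ]^2 V) :
    f (ofWedge W w) = ofWedge W' (exteriorPower.map 2 (linearPart f) w) := by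
  have map_comp_ofWedge : (f : Alg V W →ₗ[ℝ] Alg V' W') ∘ₗ ofWedge W
      = ofWedge W' ∘ₗ exteriorPower.map 2 (linearPart f) := by
    refine exteriorPower.linearMap_ext (AlternatingMap.ext fun a => ?_)
    simp only [LinearMap.compAlternatingMap_apply, LinearMap.comp_apply,
      exteriorPower.map_apply_ιMulti]
    rw [ιMulti_two_eq_wedge, ιMulti_two_eq_wedge]
    exact f.map_lie (incl W (a 0)) (incl W (a 1))
  exact LinearMap.congr_fun map_comp_ofWedge w

theorem le_comap_map_linearPart (f : Alg V W →ₗ⁅ℝ⁆ Alg V' W') :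
    W ≤ W'.comap (exteriorPower.map 2 (linearPart f)) := by
  intro w hw
  rw [Submodule.mem_comap, ← ofWedge_eq_zero_iff, ← map_ofWedge, (ofWedge_eq_zero_iff W).2 hw,
    map_zero]

theorem linearPart_proj (f : Alg V W →ₗ⁅ℝ⁆ Alg V' W') (x : Alg V W) :
    linearPart f (proj W x) = proj W' (f x) := by
  obtain ⟨w, hw⟩ := exists_eq_incl_add_ofWedge W x
  conv_rhs => rw [hw, map_add, map_ofWedge, map_add, proj_ofWedge, add_zero]
  rfl

/-- The linear isomorphism `V ≃ V'` induced by a Lie algebra isomorphism. -/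
def linearPartEquiv (f : Alg V W ≃ₗ⁅ℝ⁆ Alg V' W') : V ≃ₗ[ℝ] V' :=
  LinearEquiv.ofLinearMap (linearPart f.toLieHom) (linearPart f.symm.toLieHom)
    (LinearMap.ext fun v => (linearPart_proj f.toLieHom (f.symm (incl W' v))).trans
      (congrArg (proj W') (f.apply_symm_apply _)))
    (LinearMap.ext fun v => (linearPart_proj f.symm.toLieHom (f (incl W v))).trans
      (congrArg (proj W) (f.symm_apply_apply _)))

end LinearPart

section Orbits

variable {V : Type} [AddCommGroup V] [Module ℝ V] [FiniteDimensional ℝ V]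
  [TopologicalSpace V] [IsTopologicalAddGroup V] [ContinuousSMul ℝ V] {W : Submodule ℝ (⋀[ℝ]^2 V)}

theorem continuous_proj_log : Continuous fun g : Grp V W => proj W (log W g) :=
  (proj W).continuous_of_finiteDimensional.comp continuous_log

theorem exists_mem_proj_log_mem_of_dense {D : Set (Grp V W)} (hD : Dense D) {U : Set V}
    (hU : (interior U).Nonempty) : ∃ g ∈ D, proj W (log W g) ∈ U := by
  obtain ⟨v, hv⟩ := hU
  obtain ⟨g, hgU, hgD⟩ := hD.inter_open_nonempty _
    (isOpen_interior.preimage (continuous_proj_log (W := W))) ⟨exp W (incl W v), hv⟩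
  exact ⟨g, hgD, interior_subset hgU⟩

/-- An automorphism of the group acts on `V` by an element of the stabilizer of `W` in `GL(V)`, so
a dense orbit in the group would yield a dense orbit of the stabilizer in `V`. -/
theorem not_dense_orbit {S : Set V}
    (hS : ∀ A : V ≃ₗ[ℝ] V, W ≤ W.comap (exteriorPower.map 2 A.toLinearMap) → A ⁻¹' S ⊆ S)
    (hS_int : (interior S).Nonempty) (hS_compl_int : (interior Sᶜ).Nonempty) (g : Grp V W) :
    ¬ Dense (Set.range fun φ : Grp V W ≃ₜ* Grp V W => φ g) := by
  intro dense_orbit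
  obtain ⟨_, ⟨φ, rfl⟩, hφ⟩ := exists_mem_proj_log_mem_of_dense dense_orbit hS_int
  obtain ⟨_, ⟨ψ, rfl⟩, hψ⟩ := exists_mem_proj_log_mem_of_dense dense_orbit hS_compl_int
  let χ := toLieEquiv (ψ.symm.trans φ)
  have map_ψg : linearPartEquiv χ (proj W (log W (ψ g))) = proj W (log W (φ g)) := by
    refine (linearPart_proj χ.toLieHom _).trans (congrArg (fun h => proj W (log W (φ h))) ?_)
    exact ψ.symm_apply_apply g
  refine hψ (hS (linearPartEquiv χ) (le_comap_map_linearPart χ.toLieHom) ?_)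
  rwa [Set.mem_preimage, map_ψg]

end Orbits

section LieGroup

variable {V : Type} [AddCommGroup V] [Module ℝ V] [FiniteDimensional ℝ V]
  (W : Submodule ℝ (⋀[ℝ]^2 V))

instance : SimplyConnectedSpace (Grp V W) := inferInstanceAs (SimplyConnectedSpace (Alg V W))

/-- The bracket as a continuous bilinear map. -/
def lieCLM : Alg V W →L[ℝ] Alg V W →L[ℝ] Alg V W :=
  LinearMap.toContinuousLinearMap (LinearMap.toContinuousLinearMap.toLinearMap ∘ₗ lieBilin W)

theorem lieCLM_apply (x y : Alg V W) : lieCLM W x y = ⁅x, y⁆ := rfl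

/-- The left-invariant vector field `x ↦ v + ½ [x, v]` with value `v` at the identity, in
exponential coordinates. -/
def leftInvariantField (v x : Alg V W) : Alg V W := v + (1 / 2 : ℝ) • (lieCLM W).flip v x

theorem hasFDerivAt_leftInvariantField (v x : Alg V W) :
    HasFDerivAt (leftInvariantField W v) ((1 / 2 : ℝ) • (lieCLM W).flip v) x :=
  (((lieCLM W).flip v).hasFDerivAt.const_smul (1 / 2 : ℝ)).const_add v

theorem mulInvariantVectorField_eq_leftInvariantField (v : Alg V W) :
    (mulInvariantVectorField (I := 𝓘(ℝ, Alg V W)) (G := Grp V W) v : Alg V W → Alg V W)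
      = leftInvariantField W v := by
  refine funext fun g : Alg V W => ?_
  have hasFDerivAt_mul_left : HasFDerivAt (fun x => g + x + (1 / 2 : ℝ) • lieCLM W g x)
      (ContinuousLinearMap.id ℝ (Alg V W) + (1 / 2 : ℝ) • lieCLM W g) 0 :=
    ((hasFDerivAt_id _).const_add g).add ((lieCLM W g).hasFDerivAt.const_smul (1 / 2 : ℝ))
  exact congrArg (fun L : Alg V W →L[ℝ] Alg V W => L v)
    (mfderiv_eq_fderiv.trans hasFDerivAt_mul_left.fderiv)

theorem lieBracket_leftInvariantField (v w : Alg V W) :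
    VectorField.lieBracket ℝ (leftInvariantField W v) (leftInvariantField W w) 0 = ⁅v, w⁆ := by
  rw [VectorField.lieBracket, (hasFDerivAt_leftInvariantField W v 0).fderiv,
    (hasFDerivAt_leftInvariantField W w 0).fderiv]
  simp only [leftInvariantField, map_zero, smul_zero, add_zero, smul_apply,
    ContinuousLinearMap.flip_apply, lieCLM_apply]
  rw [← lie_skew w v]
  module

theorem mlieBracket_eq_lieBracket {𝕜 E : Type*} [NontriviallyNormedField 𝕜]
    [NormedAddCommGroup E] [NormedSpace 𝕜 E] (X Y : Π x : E, TangentSpace 𝓘(𝕜, E) x) :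
    VectorField.mlieBracket 𝓘(𝕜, E) X Y = VectorField.lieBracket 𝕜 X Y := by
  rw [← VectorField.mlieBracketWithin_univ, VectorField.mlieBracketWithin_eq_lieBracketWithin]
  exact VectorField.lieBracketWithin_univ

theorem groupLieAlgebra_lie_eq (v w : GroupLieAlgebra 𝓘(ℝ, Alg V W) (Grp V W)) :
    ⁅v, w⁆ = @Bracket.bracket (Alg V W) (Alg V W) _ v w := by
  refine (congrFun (mlieBracket_eq_lieBracket (E := Alg V W) _ _) 0).trans <|
    Eq.trans ?_ (lieBracket_leftInvariantField W v w)
  exact congrArg₂ (fun X Y : Alg V W → Alg V W => VectorField.lieBracket ℝ X Y 0)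
    (mulInvariantVectorField_eq_leftInvariantField W v)
    (mulInvariantVectorField_eq_leftInvariantField W w)

/-- The identification of the Lie algebra of `Grp V W` with `Alg V W`, which is the identity on the
underlying spaces. -/
def groupLieAlgebraEquiv : GroupLieAlgebra 𝓘(ℝ, Alg V W) (Grp V W) ≃ₗ⁅ℝ⁆ Alg V W :=
  { LinearEquiv.refl ℝ (Alg V W) with
    map_lie' := fun {v w} => groupLieAlgebra_lie_eq W v w }

end LieGroup

section Algebra

variable {V : Type} [AddCommGroup V] [Module ℝ V] (W : Submodule ℝ (⋀[ℝ]^2 V))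

theorem finrank_alg_add_finrank [FiniteDimensional ℝ V] :
    Module.finrank ℝ (Alg V W) + Module.finrank ℝ W
      = Module.finrank ℝ V + (Module.finrank ℝ V).choose 2 := by
  have finrank_alg : Module.finrank ℝ (Alg V W) = _ :=
    Module.finrank_prod (R := ℝ) (M := V) (M' := (⋀[ℝ]^2 V) ⧸ W)
  rw [finrank_alg, add_assoc, W.finrank_quotient_add_finrank, exteriorPower.finrank_eq]

variable {W}

theorem exists_lie_ne_zero (hW : W ≠ ⊤) : ∃ x y : Alg V W, ⁅x, y⁆ ≠ 0 := by
  contrapose! hW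
  have ofWedge_eq_zero : ofWedge W = 0 := by
    refine exteriorPower.linearMap_ext (AlternatingMap.ext fun a => ?_)
    rw [LinearMap.compAlternatingMap_apply, ιMulti_two_eq_wedge]
    exact hW (incl W (a 0)) (incl W (a 1))
  refine eq_top_iff.2 fun w _ => ?_
  rw [← ofWedge_eq_zero_iff, ofWedge_eq_zero, LinearMap.zero_apply]

theorem nilpotencyLength_alg (hW : W ≠ ⊤) : LieModule.nilpotencyLength (Alg V W) (Alg V W) = 2 := by
  rw [LieModule.nilpotencyLength_eq_succ_iff ℝ]
  constructor
  · have derived_le_center : LieModule.lowerCentralSeries ℝ (Alg V W) (Alg V W) 1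
        ≤ LieModule.maxTrivSubmodule ℝ (Alg V W) (Alg V W) := by
      rw [LieModule.lowerCentralSeries_succ, LieSubmodule.lie_le_iff]
      exact fun y _ z _ x => lie_lie_eq_zero W x y z
    rw [LieModule.lowerCentralSeries_succ, LieSubmodule.lie_eq_bot_iff]
    exact fun x _ y hy => derived_le_center hy x
  · obtain ⟨x, y, hxy⟩ := exists_lie_ne_zero hW
    rw [Ne, ← LieModule.trivial_iff_lower_central_eq_bot]
    exact fun h => hxy (h.trivial x y)

end Algebra

section VolumeForm

variable {R M : Type*} [CommRing R] [AddCommGroup M] [Module R M] {n : ℕ}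

/-- The linear form on the exterior algebra that is the determinant with respect to the basis `e` in
degree `n = rank M` and zero in all other degrees. -/
def detForm (e : Module.Basis (Fin n) R M) : ExteriorAlgebra R M →ₗ[R] R :=
  ExteriorAlgebra.liftAlternating (Pi.single n e.det)

theorem detForm_ιMulti (e : Module.Basis (Fin n) R M) (a : Fin n → M) :
    detForm e (ExteriorAlgebra.ιMulti R n a) = e.det a := by
  rw [detForm, ExteriorAlgebra.liftAlternating_apply_ιMulti, Pi.single_eq_same]

theorem detForm_ιMulti_of_ne (e : Module.Basis (Fin n) R M) {i : ℕ} (h : i ≠ n) (a : Fin i → M) :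
    detForm e (ExteriorAlgebra.ιMulti R i a) = 0 := by
  rw [detForm, ExteriorAlgebra.liftAlternating_apply_ιMulti, Pi.single_eq_of_ne h,
    AlternatingMap.zero_apply]

theorem detForm_map (e : Module.Basis (Fin n) R M) (A : M →ₗ[R] M) (x : ExteriorAlgebra R M) :
    detForm e (ExteriorAlgebra.map A x) = LinearMap.det A * detForm e x := by
  suffices detForm e ∘ₗ (ExteriorAlgebra.map A).toLinearMap = LinearMap.det A • detForm e from
    LinearMap.congr_fun this x
  refine ExteriorAlgebra.lhom_ext fun i => AlternatingMap.ext fun a => ?_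
  simp only [LinearMap.compAlternatingMap_apply, LinearMap.comp_apply, AlgHom.toLinearMap_apply,
    LinearMap.smul_apply, ExteriorAlgebra.map_apply_ιMulti, smul_eq_mul]
  rcases eq_or_ne i n with rfl | hi
  · rw [detForm_ιMulti, detForm_ιMulti, Module.Basis.det_comp]
  · rw [detForm_ιMulti_of_ne e hi, detForm_ιMulti_of_ne e hi, mul_zero]

theorem coe_exteriorPower_map {N : Type*} [AddCommGroup N] [Module R N] (A : M →ₗ[R] N)
    (w : ⋀[R]^n M) :
    (exteriorPower.map n A w : ExteriorAlgebra R N) = ExteriorAlgebra.map A w := by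
  suffices (⋀[R]^n N).subtype ∘ₗ exteriorPower.map n A
      = (ExteriorAlgebra.map A).toLinearMap ∘ₗ (⋀[R]^n M).subtype from
    LinearMap.congr_fun this w
  refine exteriorPower.linearMap_ext (AlternatingMap.ext fun a => ?_)
  simp only [LinearMap.compAlternatingMap_apply, LinearMap.comp_apply, Submodule.subtype_apply,
    exteriorPower.map_apply_ιMulti, exteriorPower.ιMulti_apply_coe, AlgHom.toLinearMap_apply,
    ExteriorAlgebra.map_apply_ιMulti]

theorem detForm_map_mul_self_mul_ι (e : Module.Basis (Fin n) R M) (A : M →ₗ[R] M) {k : ℕ}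
    (w : ⋀[R]^k M) (m : M) :
    detForm e ((exteriorPower.map k A w : ExteriorAlgebra R M) * exteriorPower.map k A w
        * ExteriorAlgebra.ι R (A m))
      = LinearMap.det A * detForm e ((w : ExteriorAlgebra R M) * w * ExteriorAlgebra.ι R m) := by
  rw [← detForm_map, map_mul (ExteriorAlgebra.map A), map_mul (ExteriorAlgebra.map A),
    ExteriorAlgebra.map_apply_ι, coe_exteriorPower_map]

end VolumeForm

section QuadraticForms

theorem toQuadraticForm'_apply {R n : Type*} [CommRing R] [Fintype n] [DecidableEq n]
    (M : Matrix n n R) (u : n → R) : M.toQuadraticForm' u = u ⬝ᵥ M.mulVec u :=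
  Matrix.toLinearMap₂'_apply' M u u

theorem not_anisotropic_of_neg_of_pos {E : Type*} [AddCommGroup E] [Module ℝ E]
    {Q : QuadraticForm ℝ E} {x y : E} (hx : Q x < 0) (hy : 0 < Q y) : ¬ Q.Anisotropic := by
  have Q_line (t : ℝ) : Q (x + t • y) = Q y * (t * t) + QuadraticMap.polar Q x y * t + Q x := by
    rw [QuadraticMap.map_add Q, QuadraticMap.map_smul, QuadraticMap.polar_smul_right, smul_eq_mul,
      smul_eq_mul]
    ring
  have discrim_nonneg : 0 ≤ discrim (Q y) (QuadraticMap.polar Q x y) (Q x) := by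
    rw [discrim]
    nlinarith [sq_nonneg (QuadraticMap.polar Q x y), mul_pos hy (neg_pos.2 hx)]
  obtain ⟨t, ht⟩ := exists_quadratic_eq_zero hy.ne' ⟨_, (Real.mul_self_sqrt discrim_nonneg).symm⟩
  intro hQ
  have x_eq : x = -t • y := by
    rw [neg_smul]
    exact eq_neg_of_add_eq_zero_left (hQ _ ((Q_line t).trans ht))
  rw [x_eq, QuadraticMap.map_smul, smul_eq_mul] at hx
  nlinarith [mul_self_nonneg (-t)]

theorem not_anisotropic_of_diag {n : Type*} [Fintype n] [DecidableEq n] {M : Matrix n n ℝ}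
    {i j : n} (hi : M i i < 0) (hj : 0 < M j j) : ¬ M.toQuadraticForm'.Anisotropic := by
  have apply_single (k : n) : M.toQuadraticForm' (Pi.single k 1) = M k k := by
    rw [toQuadraticForm'_apply, Matrix.mulVec_single_one, single_one_dotProduct, Matrix.col_apply]
  exact not_anisotropic_of_neg_of_pos ((apply_single i).trans_lt hi)
    (hj.trans_eq (apply_single j).symm)

theorem isOpen_setOf_anisotropic {n : Type*} [Fintype n] [DecidableEq n] :
    IsOpen {M : Matrix n n ℝ | M.toQuadraticForm'.Anisotropic} := by
  let isotropicPairs : Set (Matrix n n ℝ × Metric.sphere (0 : n → ℝ) 1) :=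
    {p | p.2.1 ⬝ᵥ p.1.mulVec p.2.1 = 0}
  have isClosed_pairs : IsClosed isotropicPairs :=
    isClosed_eq (by fun_prop) continuous_const
  suffices {M : Matrix n n ℝ | M.toQuadraticForm'.Anisotropic}ᶜ = Prod.fst '' isotropicPairs from
    isClosed_compl_iff.1 (this ▸ isClosedMap_fst_of_compactSpace _ isClosed_pairs)
  ext M
  rw [Set.mem_compl_iff, Set.mem_ofPred_eq, QuadraticMap.not_anisotropic_iff_exists]
  constructor
  · rintro ⟨u, hu, hMu⟩
    refine ⟨(M, ⟨‖u‖⁻¹ • u, ?_⟩), ?_, rfl⟩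
    · rw [mem_sphere_zero_iff_norm, norm_smul, norm_inv, norm_norm,
        inv_mul_cancel₀ (norm_ne_zero_iff.2 hu)]
    · change (‖u‖⁻¹ • u) ⬝ᵥ M.mulVec (‖u‖⁻¹ • u) = 0
      rw [← toQuadraticForm'_apply, QuadraticMap.map_smul, hMu, smul_zero]
  · rintro ⟨⟨M, u⟩, hMu, rfl⟩
    refine ⟨u, ?_, (toQuadraticForm'_apply M u).trans hMu⟩
    exact norm_ne_zero_iff.1 (by rw [norm_eq_of_mem_sphere]; exact one_ne_zero)

end QuadraticForms

section ExteriorAlgebra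

variable {R M : Type*} [CommRing R] [AddCommGroup M] [Module R M]

local notation "ι" => ExteriorAlgebra.ι R

theorem ι_mul_ι_eq_neg (a b : M) : ι a * ι b = -(ι b * ι a) :=
  eq_neg_of_add_eq_zero_left (ExteriorAlgebra.ι_add_mul_swap a b)

theorem ι_mul_ι_mul_self (a b : M) : ι a * ι b * (ι a * ι b) = 0 := by
  rw [mul_assoc, ← mul_assoc (ι b), ι_mul_ι_eq_neg b a, neg_mul, mul_neg, mul_assoc (ι a),
    ExteriorAlgebra.ι_sq_zero, mul_zero, mul_zero, neg_zero]

theorem commute_ι_mul_ι_ι (a b c : M) : Commute (ι a * ι b) (ι c) := by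
  rw [Commute, SemiconjBy, mul_assoc, ι_mul_ι_eq_neg b, mul_neg, ← mul_assoc, ι_mul_ι_eq_neg a c,
    neg_mul, neg_neg, mul_assoc]

theorem commute_ι_mul_ι_ι_mul_ι (a b c d : M) : Commute (ι a * ι b) (ι c * ι d) :=
  (commute_ι_mul_ι_ι a b c).mul_right (commute_ι_mul_ι_ι a b d)

theorem ι_mul_ι_add_add_mul_self (a b c d e f : M) :
    (ι a * ι b + ι c * ι d + ι e * ι f) * (ι a * ι b + ι c * ι d + ι e * ι f)
      = 2 • (ι a * ι b * (ι c * ι d) + ι a * ι b * (ι e * ι f) + ι c * ι d * (ι e * ι f)) := by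
  rw [add_mul, add_mul]
  simp only [mul_add, ι_mul_ι_mul_self, (commute_ι_mul_ι_ι_mul_ι c d a b).eq,
    (commute_ι_mul_ι_ι_mul_ι e f a b).eq, (commute_ι_mul_ι_ι_mul_ι e f c d).eq]
  abel

theorem ι_mul_ι_mul_ι_mul_ι_mul_ι (a b c d f : M) :
    ι a * ι b * (ι c * ι d) * ι f = ExteriorAlgebra.ιMulti R 5 ![a, b, c, d, f] := by
  simp [ExteriorAlgebra.ιMulti_apply, mul_assoc]

theorem detForm_ι_mul_ι_add_add_mul_self_mul_ι (v : Module.Basis (Fin 5) R M)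
    (a b c d e f m : M) :
    detForm v ((ι a * ι b + ι c * ι d + ι e * ι f) * (ι a * ι b + ι c * ι d + ι e * ι f) * ι m)
      = 2 * (v.det ![a, b, c, d, m] + v.det ![a, b, e, f, m] + v.det ![c, d, e, f, m]) := by
  rw [ι_mul_ι_add_add_mul_self, smul_mul_assoc, map_nsmul, nsmul_eq_mul, Nat.cast_ofNat, add_mul,
    add_mul, map_add, map_add]
  simp only [ι_mul_ι_mul_ι_mul_ι_mul_ι, detForm_ιMulti]

theorem coe_wedge {E : Type} [AddCommGroup E] [Module ℝ E] (a b : E) :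
    (wedge a b : ExteriorAlgebra ℝ E) = ExteriorAlgebra.ι ℝ a * ExteriorAlgebra.ι ℝ b := by
  simp [wedge, ExteriorAlgebra.ιMulti_apply]

end ExteriorAlgebra

section Stabilizer

/-- The coordinates of an element of `V` in the basis `σ₁, …, σ₅`. -/
def coords : V ≃ₗ[ℝ] (Fin 5 → ℝ) where
  toFun σ := ![σ.1 0 0 / 2, σ.1 0 1, σ.1 0 2, σ.1 1 2, σ.1 2 2 / 2]
  map_add' σ τ := by
    ext i; fin_cases i <;> simp [add_div]
  map_smul' c σ := by
    ext i; fin_cases i <;> simp [mul_div_assoc]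
  invFun t := ⟨!![2 * t 0, t 1, t 2; t 1, 2 * t 2, t 3; t 2, t 3, 2 * t 4], by
    rw [mem_V, Matrix.IsSymm.ext_iff]
    refine ⟨by simp [Fin.forall_fin_succ], ?_⟩
    change 2 * t 2 = t 2 + t 2
    ring⟩
  left_inv := by
    rintro ⟨σ, hσ, hσ'⟩
    have σ_apply := hσ.apply
    rw [σ_apply 0 2] at hσ'
    ext i j
    fin_cases i <;> fin_cases j <;> simp [σ_apply 0 1, σ_apply 0 2, σ_apply 1 2, hσ'] <;> ring
  right_inv t := by
    ext i; fin_cases i <;> simp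

theorem coords_σ₁ : coords σ₁ = ![1, 0, 0, 0, 0] := by
  ext i; fin_cases i <;> simp [coords, σ₁]

theorem coords_σ₂ : coords σ₂ = ![0, 1, 0, 0, 0] := by
  ext i; fin_cases i <;> simp [coords, σ₂]

theorem coords_σ₃ : coords σ₃ = ![0, 0, 1, 0, 0] := by
  ext i; fin_cases i <;> simp [coords, σ₃]

theorem coords_σ₄ : coords σ₄ = ![0, 0, 0, 1, 0] := by
  ext i; fin_cases i <;> simp [coords, σ₄]

theorem coords_σ₅ : coords σ₅ = ![0, 0, 0, 0, 1] := by
  ext i; fin_cases i <;> simp [coords, σ₅]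

/-- The basis `σ₁, …, σ₅` of `V`. -/
def basisV : Module.Basis (Fin 5) ℝ V := Module.Basis.ofEquivFun coords

theorem finrank_V : Module.finrank ℝ V = 5 := by
  rw [Module.finrank_eq_card_basis basisV, Fintype.card_fin]

/-- The parametrization of `W` by `u ∈ ℝ³` for which `w ∧ w ∧ σ` becomes the quadratic form
`-uᵀ σ u`. -/
def toW : (Fin 3 → ℝ) →ₗ[ℝ] ⋀[ℝ]^2 V :=
  Fintype.linearCombination ℝ ![wedge σ₂ σ₅ - wedge σ₃ σ₄, -(wedge σ₁ σ₅ - wedge σ₂ σ₄),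
    wedge σ₁ σ₄ - wedge σ₂ σ₃]

theorem toW_apply (u : Fin 3 → ℝ) :
    toW u = u 2 • (wedge σ₁ σ₄ - wedge σ₂ σ₃) + -u 1 • (wedge σ₁ σ₅ - wedge σ₂ σ₄)
      + u 0 • (wedge σ₂ σ₅ - wedge σ₃ σ₄) := by
  simp only [toW, Fintype.linearCombination_apply, Fin.sum_univ_three, Matrix.cons_val]
  module

theorem range_toW : LinearMap.range toW = W := by
  ext w
  rw [W, Submodule.mem_span_triple, LinearMap.mem_range]
  constructor
  · rintro ⟨u, rfl⟩
    exact ⟨u 2, -u 1, u 0, (toW_apply u).symm⟩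
  · rintro ⟨x, y, z, rfl⟩
    refine ⟨![z, -y, x], ?_⟩
    rw [toW_apply]
    simp

theorem coe_toW (u : Fin 3 → ℝ) :
    (toW u : ExteriorAlgebra ℝ V)
      = ExteriorAlgebra.ι ℝ σ₁ * ExteriorAlgebra.ι ℝ (u 2 • σ₄ - u 1 • σ₅)
        + ExteriorAlgebra.ι ℝ σ₂ * ExteriorAlgebra.ι ℝ (u 1 • σ₄ + u 0 • σ₅ - u 2 • σ₃)
        + ExteriorAlgebra.ι ℝ (-u 0 • σ₃) * ExteriorAlgebra.ι ℝ σ₄ := by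
  simp only [toW_apply, Submodule.coe_add, Submodule.coe_sub, Submodule.coe_smul, coe_wedge,
    map_add, map_sub, map_smul, mul_add, mul_sub, mul_smul_comm, smul_mul_assoc]
  module

theorem basisV_det (v : Fin 5 → V) :
    basisV.det v = Matrix.det (Matrix.of fun i => coords (v i)) := by
  rw [Module.Basis.det_apply, ← Matrix.det_transpose]
  rfl

theorem toQuadraticForm'_coords_symm (t : Fin 5 → ℝ) (u : Fin 3 → ℝ) :
    (coords.symm t).1.toQuadraticForm' u = 2 * (t 0 * u 0 ^ 2 + t 1 * (u 0 * u 1)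
      + t 2 * (u 1 ^ 2 + u 0 * u 2) + t 3 * (u 1 * u 2) + t 4 * u 2 ^ 2) := by
  simp [toQuadraticForm'_apply, coords, dotProduct, Matrix.mulVec, Fin.sum_univ_three]
  ring

theorem detForm_toW_mul_self_mul_ι (u : Fin 3 → ℝ) (σ : V) :
    detForm basisV ((toW u : ExteriorAlgebra ℝ V) * toW u * ExteriorAlgebra.ι ℝ σ)
      = -σ.1.toQuadraticForm' u := by
  rw [coe_toW, detForm_ι_mul_ι_add_add_mul_self_mul_ι]
  obtain ⟨t, rfl⟩ := coords.symm.surjective σ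
  have det₁₂ : basisV.det ![σ₁, u 2 • σ₄ - u 1 • σ₅, σ₂, u 1 • σ₄ + u 0 • σ₅ - u 2 • σ₃,
      coords.symm t] = -(t 2 * (u 1 ^ 2 + u 0 * u 2) + t 3 * (u 1 * u 2) + t 4 * u 2 ^ 2) := by
    simp [basisV_det, Matrix.det_succ_row_zero, Fin.sum_univ_succ, Fin.succAbove, coords_σ₁,
      coords_σ₂, coords_σ₃, coords_σ₄, coords_σ₅]
    ring
  have det₁₄ : basisV.det ![σ₁, u 2 • σ₄ - u 1 • σ₅, -u 0 • σ₃, σ₄, coords.symm t]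
      = -(t 1 * (u 0 * u 1)) := by
    simp [basisV_det, Matrix.det_succ_row_zero, Fin.sum_univ_succ, Fin.succAbove, coords_σ₁,
      coords_σ₃, coords_σ₄, coords_σ₅]
    ring
  have det₂₄ : basisV.det ![σ₂, u 1 • σ₄ + u 0 • σ₅ - u 2 • σ₃, -u 0 • σ₃, σ₄, coords.symm t]
      = -(t 0 * u 0 ^ 2) := by
    simp [basisV_det, Matrix.det_succ_row_zero, Fin.sum_univ_succ, Fin.succAbove, coords_σ₂,
      coords_σ₃, coords_σ₄, coords_σ₅]
    ring
  rw [det₁₂, det₁₄, det₂₄, toQuadraticForm'_coords_symm]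
  ring

/-- The set of (positive or negative) definite matrices in `V`, encoded by anisotropy of the
quadratic form. -/
def anisotropicSet : Set V := {σ | σ.1.toQuadraticForm'.Anisotropic}

theorem anisotropic_σ₁_add_σ₃_add_σ₅ : (σ₁ + σ₃ + σ₅).1.toQuadraticForm'.Anisotropic := by
  intro u hu
  have sum_sq_eq_zero : u 0 ^ 2 + u 2 ^ 2 + (u 0 + u 2) ^ 2 + 2 * u 1 ^ 2 = 0 := by
    rw [← hu, toQuadraticForm'_apply]
    simp [σ₁, σ₃, σ₅, Matrix.mulVec, dotProduct, Fin.sum_univ_succ]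
    ring
  ext i
  refine pow_eq_zero_iff two_ne_zero |>.1 (le_antisymm ?_ (sq_nonneg (u i)))
  fin_cases i <;> simp only [Fin.zero_eta, Fin.mk_one, Fin.reduceFinMk] <;>
    nlinarith only [sum_sq_eq_zero, sq_nonneg (u 0), sq_nonneg (u 1), sq_nonneg (u 2),
      sq_nonneg (u 0 + u 2)]

theorem interior_anisotropicSet_nonempty : (interior anisotropicSet).Nonempty :=
  ⟨σ₁ + σ₃ + σ₅, interior_maximal subset_rfl
    (isOpen_setOf_anisotropic.preimage continuous_subtype_val) anisotropic_σ₁_add_σ₃_add_σ₅⟩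

theorem interior_compl_anisotropicSet_nonempty : (interior anisotropicSetᶜ).Nonempty := by
  have isOpen_diag : IsOpen {σ : V | σ.1 0 0 < 0 ∧ 0 < σ.1 2 2} :=
    (isOpen_lt (continuous_subtype_val.matrix_elem 0 0) continuous_const).inter
      (isOpen_lt continuous_const (continuous_subtype_val.matrix_elem 2 2))
  refine ⟨-σ₁ + σ₅, interior_maximal (fun σ hσ => not_anisotropic_of_diag hσ.1 hσ.2) isOpen_diag ?_⟩
  simp [σ₁, σ₅]

theorem toW_injective : Function.Injective toW := by
  refine (injective_iff_map_eq_zero toW).2 fun u hu => anisotropic_σ₁_add_σ₃_add_σ₅ u ?_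
  rw [← neg_eq_zero, ← detForm_toW_mul_self_mul_ι, hu, ZeroMemClass.coe_zero, zero_mul, zero_mul,
    map_zero]

theorem finrank_W : Module.finrank ℝ W = 3 := by
  rw [← range_toW, LinearMap.finrank_range_of_inj toW_injective, Module.finrank_fin_fun]

theorem W_ne_top : W ≠ ⊤ := by
  intro W_eq_top
  have := finrank_W
  rw [W_eq_top, finrank_top, exteriorPower.finrank_eq, finrank_V] at this
  exact absurd this (by decide)

theorem finrank_𝔤 : Module.finrank ℝ 𝔤 = 12 := by
  have finrank_add_three := finrank_alg_add_finrank W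
  rw [finrank_W, finrank_V] at finrank_add_three
  exact Nat.add_right_cancel finrank_add_three

theorem preimage_anisotropicSet_subset (A : V ≃ₗ[ℝ] V)
    (hA : W ≤ W.comap (exteriorPower.map 2 A.toLinearMap)) :
    A ⁻¹' anisotropicSet ⊆ anisotropicSet := by
  intro σ hσ u (hu : σ.1.toQuadraticForm' u = 0)
  obtain ⟨u', hu'⟩ : exteriorPower.map 2 A.toLinearMap (toW u) ∈ LinearMap.range toW :=
    range_toW ▸ hA (range_toW ▸ LinearMap.mem_range_self toW u)
  have apply_u'_eq_zero : (A σ).1.toQuadraticForm' u' = 0 := by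
    rw [← neg_eq_zero, ← detForm_toW_mul_self_mul_ι, hu', ← LinearEquiv.coe_coe,
      detForm_map_mul_self_mul_ι, detForm_toW_mul_self_mul_ι, hu, neg_zero, mul_zero]
  have map_toW_eq_zero : exteriorPower.map 2 A.toLinearMap (toW u) = 0 := by
    rw [← hu', hσ u' apply_u'_eq_zero, map_zero]
  refine (injective_iff_map_eq_zero toW).1 toW_injective u ?_
  exact (injective_iff_map_eq_zero _).1 (exteriorPower.map_injective_field A.injective) _
    map_toW_eq_zero

end Stabilizer

end TwoStep

end

theorem mainTheorem2 :
    Module.finrank ℝ TwoStep.𝔤 = 12 ∧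
    LieModule.nilpotencyLength TwoStep.𝔤 TwoStep.𝔤 = 2 ∧
    SimplyConnectedSpace TwoStep.G ∧
    Nonempty (GroupLieAlgebra 𝓘(ℝ, TwoStep.𝔤) TwoStep.G ≃ₗ⁅ℝ⁆ TwoStep.𝔤) ∧
    ∀ g : TwoStep.G, ¬ Dense (Set.range fun φ : TwoStep.G ≃ₜ* TwoStep.G => φ g) :=
  ⟨TwoStep.finrank_𝔤, TwoStep.nilpotencyLength_alg TwoStep.W_ne_top, inferInstance,
    ⟨TwoStep.groupLieAlgebraEquiv TwoStep.W⟩,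
    TwoStep.not_dense_orbit TwoStep.preimage_anisotropicSet_subset
      TwoStep.interior_anisotropicSet_nonempty TwoStep.interior_compl_anisotropicSet_nonempty⟩
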